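/- Work over $\mathbb C$, with the classical topology on projective spaces. Let $X\subset\mathbb P^3$ be a smooth irreducible closed algebraic curve that is not contained in a plane. For points $O_1,O_2\in\mathbb P^3$ let $\pi_i:\mathbb P^3\setminus\{O_i\}\to\mathbb P^2$ be a projection with centre $O_i$, given by a $3\times4$ matrix $M_i$ of rank $3$ with $M_iO_i=0$. Let $Y_i=\pi_i(X)$, and let $\phi_i$ be an irreducible homogeneous equation of the dual curve $Y_i^*$ (the set of lines tangent to $Y_i$). Let $$V\subset\mathbb P^2\times\mathbb P^8\times\mathbb P^2$$ be the set of triples $(e_1,F,e_2)$, with $F$ a nonzero $3\times3$ matrix up to scale, such that $Fe_1=0$, $e_2^TF=0$, and for some scalar $\lambda\neq0$ $$\phi_2(Fp)=\lambda\,\phi_1(e_1\times p)\qquad\text{for all }p\in\mathbb C^3 .$$ For $e\in\mathbb P^2$, a tangency point of $Y_i$ for $e$ is a point $q\in Y_i$ at which some line through $e$ is tangent to $Y_i$. (A line $l$ is tangent to $Y_i$ at $q$ if $(q,l)$ lies in the conormal variety of $Y_i$, the closure of the set of pairs formed by a smooth point and the tangent line there; $Y_i^*$ is the set of these $l$.)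 Two projections with matrices $N_1,N_2$ and centres $C_1,C_2$ realize $(e_1,F,e_2)$ if $F$ is their fundamental matrix (the matrix that sends a point $p$ of the first plane to the line which is the image, under the second projection, of the preimage of $p$ under the first), $e_1$ is the image of $C_2$ under $N_1$, and $e_2$ is the image of $C_1$ under $N_2$. Such a pair, when it exists, is unique up to a projective transformation of $\mathbb P^3$ and rescaling of the matrices. Given such a pair, let $L$ be the baseline, the line joining $C_1$ and $C_2$, and let $\{Q_\alpha\}$ be the set of all points of $\mathbb P^3$ that $N_1$ sends to a tangency point of $Y_1$ for $e_1$ and $N_2$ sends to a tangency point of $Y_2$ for $e_2$. A quadric surface is the zero set of a nonzero quadratic form on $\mathbb C^4$; it may be singular or reducible. **Proposition.** There is a nonempty Zariski-open subset of $\mathbb P^3\times\mathbb P^3$, depending only on $X$, such that for all $(O_1,O_2)$ in it and all projections $\pi_1,\pi_2$ with these centres the following holds. If every point $(e_1,F,e_2)\in V$ is realized by a pair of projections for which $L\cup\{Q_\alpha\}$ is not contained in any quadric surface, then $V$ is discrete: each of its points is isolated, and, equivalently for such an algebraic set, $V$ is finite. -/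

import Mathlib

open scoped LinearAlgebra.Projectivization Matrix

noncomputable section

namespace TwoViews

/-- The complex projective plane. -/
abbrev P2 : Type := ℙ ℂ (Fin 3 → ℂ)

/-- Complex projective three-space. -/
abbrev P3 : Type := ℙ ℂ (Fin 4 → ℂ)

/-- The projective space of nonzero `3 × 3` matrices up to scale. -/
abbrev P8 : Type := ℙ ℂ (Matrix (Fin 3) (Fin 3) ℂ)

/-- The classical topology of a complex projective space: the quotient topology from the space of
nonzero vectors. -/
instance projectiveTopology (E : Type*) [AddCommGroup E] [Module ℂ E] [TopologicalSpace E] :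
    TopologicalSpace (ℙ ℂ E) :=
  TopologicalSpace.coinduced
    (fun v : { v : E // v ≠ 0 } => Projectivization.mk ℂ v.1 v.2) inferInstance

/-- The gradient of a polynomial at a point. -/
def gradient {ι : Type*} (f : MvPolynomial ι ℂ) (v : ι → ℂ) : ι → ℂ :=
  fun i => MvPolynomial.eval v (MvPolynomial.pderiv i f)

/-- The homogeneous ideal of a set of points of a projective space. -/
def idealOf {ι : Type*} (X : Set (ℙ ℂ (ι → ℂ))) : Ideal (MvPolynomial ι ℂ) :=
  MvPolynomial.vanishingIdeal ℂ { v : ι → ℂ | ∃ hv : v ≠ 0, Projectivization.mk ℂ v hv ∈ X }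

/-- `X` is a smooth irreducible closed algebraic curve in projective three-space. -/
structure IsSmoothIrreducibleCurve (X : Set P3) : Prop where
  closed : ∀ x : P3, (∀ g ∈ idealOf X, MvPolynomial.eval x.rep g = 0) → x ∈ X
  irreducible : (idealOf X).IsPrime
  -- the affine cone over a curve is a surface
  dim_eq_one : ringKrullDim (MvPolynomial (Fin 4) ℂ ⧸ idealOf X) = 2
  -- Jacobian criterion in codimension two
  smooth : ∀ x ∈ X, Module.finrank ℂ
    (Submodule.span ℂ { w : Fin 4 → ℂ | ∃ g ∈ idealOf X, w = gradient g x.rep }) = 2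

/-- All points of `X` lie in one plane. -/
def IsPlanar (X : Set P3) : Prop :=
  ∃ h : Fin 4 → ℂ, h ≠ 0 ∧ ∀ x ∈ X, h ⬝ᵥ x.rep = 0

/-- `M` is the matrix of a projection of three-space onto a plane with centre `O`. -/
def IsProjectionFrom (M : Matrix (Fin 3) (Fin 4) ℂ) (O : P3) : Prop :=
  M.rank = 3 ∧ M *ᵥ O.rep = 0

/-- The projection with matrix `M` is defined at `P` and sends it to `p`. -/
def ProjectsTo (M : Matrix (Fin 3) (Fin 4) ℂ) (P : P3) (p : P2) : Prop :=
  ∃ c : ℂ, c ≠ 0 ∧ M *ᵥ P.rep = c • p.rep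

/-- The image of a set of points under the projection with matrix `M`. -/
def projected (M : Matrix (Fin 3) (Fin 4) ℂ) (X : Set P3) : Set P2 :=
  { p | ∃ P ∈ X, ProjectsTo M P p }

/-- `f` is an irreducible homogeneous equation of the plane curve `Y`. -/
def IsEquationOf (f : MvPolynomial (Fin 3) ℂ) (Y : Set P2) : Prop :=
  Irreducible f ∧ (∃ n : ℕ, f.IsHomogeneous n) ∧
    ∀ p : P2, p ∈ Y ↔ MvPolynomial.eval p.rep f = 0

/-- The line with coordinate vector `l` is tangent to the plane curve `f = 0` at `q`: the pair
`(q, l)` lies in the conormal variety of the curve, the Zariski closure in `P2 × P2` of the pairs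
(smooth point, tangent line there). At a node these are the tangents to the two branches.
The pairs of vectors below are closed under separate rescaling, so the polynomials that vanish on
them form the bihomogeneous ideal of the set of pairs. -/
def IsTangentAt (f : MvPolynomial (Fin 3) ℂ) (q l : P2) : Prop :=
  ∀ g : MvPolynomial (Fin 3 ⊕ Fin 3) ℂ,
    (∀ u w : Fin 3 → ℂ, u ≠ 0 → w ≠ 0 → MvPolynomial.eval u f = 0 →
      (∃ c : ℂ, w = c • gradient f u) → MvPolynomial.eval (Sum.elim u w) g = 0) →
    MvPolynomial.eval (Sum.elim q.rep l.rep) g = 0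

/-- The dual curve: the set of all tangent lines. -/
def dualCurve (f : MvPolynomial (Fin 3) ℂ) : Set P2 :=
  { l | ∃ q : P2, IsTangentAt f q l }

/-- The points at which a line through `e` is tangent to the curve `f = 0`. -/
def tangencyPoints (f : MvPolynomial (Fin 3) ℂ) (e : P2) : Set P2 :=
  { q | ∃ l : P2, IsTangentAt f q l ∧ l.rep ⬝ᵥ e.rep = 0 }

/-- The generalized Kruppa equation: `φ₂(F p) = lam φ₁(e₁ × p)` for all `p`, with `lam ≠ 0`. -/
def KruppaEquation (φ₁ φ₂ : MvPolynomial (Fin 3) ℂ) (e₁ : P2) (F : P8) : Prop :=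
  ∃ lam : ℂ, lam ≠ 0 ∧ ∀ p : Fin 3 → ℂ,
    MvPolynomial.eval (F.rep *ᵥ p) φ₂ = lam * MvPolynomial.eval (e₁.rep ⨯₃ p) φ₁

/-- The variety of triples `(e₁, F, e₂)` with the generalized Kruppa equation, `F e₁ = 0` and
`e₂ᵀ F = 0`. -/
def kruppaVariety (φ₁ φ₂ : MvPolynomial (Fin 3) ℂ) : Set (P2 × P8 × P2) :=
  { T | KruppaEquation φ₁ φ₂ T.1 T.2.1 ∧ T.2.1.rep *ᵥ T.1.rep = 0 ∧
    T.2.2.rep ᵥ* T.2.1.rep = 0 }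

/-- The fundamental matrix of two projections. The preimage of the `j`-th coordinate point of the
first plane is the meet of the planes given by rows `j + 1`, `j + 2` of `M₁` (indices mod 3), and
likewise for `M₂`; the entry at `(i, j)` is the incidence pairing of two such lines. So `F p` is the
image under the second projection of the preimage line of `p` under the first. -/
def fundamentalMatrix (M₁ M₂ : Matrix (Fin 3) (Fin 4) ℂ) : Matrix (Fin 3) (Fin 3) ℂ :=
  Matrix.of fun i j =>
    (Matrix.of ![M₂ (i + 1), M₂ (i + 2), M₁ (j + 1), M₁ (j + 2)]).det

/-- The pair of projections `N₁, N₂` has the epipolar geometry `(e₁, F, e₂)`: its fundamental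
matrix is `F`, the first epipole `e₁` is the image of the second centre, and the second epipole
`e₂` is the image of the first centre. -/
def Realizes (N₁ N₂ : Matrix (Fin 3) (Fin 4) ℂ) (T : P2 × P8 × P2) : Prop :=
  (∃ c : ℂ, c ≠ 0 ∧ fundamentalMatrix N₁ N₂ = c • T.2.1.rep) ∧
  ∃ C₁ C₂ : P3, IsProjectionFrom N₁ C₁ ∧ IsProjectionFrom N₂ C₂ ∧
    ProjectsTo N₁ C₂ T.1 ∧ ProjectsTo N₂ C₁ T.2.2

/-- The line that joins the centres of two projections. -/
def baseline (N₁ N₂ : Matrix (Fin 3) (Fin 4) ℂ) : Set P3 :=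
  { P | P.rep ∈ LinearMap.ker N₁.mulVecLin ⊔ LinearMap.ker N₂.mulVecLin }

/-- The points of three-space that project to a tangency point of an epipolar line in both
planes. -/
def spaceTangencyPoints (f₁ f₂ : MvPolynomial (Fin 3) ℂ) (N₁ N₂ : Matrix (Fin 3) (Fin 4) ℂ)
    (e₁ e₂ : P2) : Set P3 :=
  { Q | (∃ q₁ ∈ tangencyPoints f₁ e₁, ProjectsTo N₁ Q q₁) ∧
    ∃ q₂ ∈ tangencyPoints f₂ e₂, ProjectsTo N₂ Q q₂ }

/-- The set `S` lies on some quadric surface, possibly singular or reducible. -/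
def LiesOnQuadric (S : Set P3) : Prop :=
  ∃ B : QuadraticForm ℂ (Fin 4 → ℂ), B ≠ 0 ∧ ∀ P ∈ S, B P.rep = 0

/-- `R O₁ O₂` holds for a generic pair of points: for all pairs in the nonempty Zariski-open subset
of `P3 × P3` where some nonzero polynomial in the two coordinate vectors is not identically zero on
the representatives. -/
def ForGenericCentres (R : P3 → P3 → Prop) : Prop :=
  ∃ G : MvPolynomial (Fin 4 ⊕ Fin 4) ℂ, G ≠ 0 ∧
    ∀ (u v : Fin 4 → ℂ) (hu : u ≠ 0) (hv : v ≠ 0), MvPolynomial.eval (Sum.elim u v) G ≠ 0 →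
      R (Projectivization.mk ℂ u hu) (Projectivization.mk ℂ v hv)

end TwoViews

end

/-!
Suppose infinitely many triples are realized by pairs of projections as in the hypothesis. Take a
sequence of distinct ones and pass to the ultrapower `K` of `ℂ`. The limit `F` of the fundamental
matrices, scaled so that one entry is `1`, has an entry outside `ℂ`, so some `ℂ`-derivation `D` of
`K` moves it. Consider the quadratic form `x ↦ (N₂ x)ᵀ (D F) (N₁ x)` on `K⁴`. It is nonzero,
because the epipolar constraint determines `F` up to scale. It vanishes on the limit of the
baselines and at limits of space tangency points: apply `D` to the epipolar constraint there, and
use that a tangent line to `Y_i` at a point contains the velocity of that point. Hence the quadrics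
of the sequence that approximate this form contain the baselines and the space tangency points,
which contradicts the hypothesis.
-/

namespace TwoViews

section Derivations

variable {k K : Type*} [Field k] [Field K]

open Polynomial in
theorem formallySmooth_polynomial [CharZero k] [Algebra k[X] K] [FaithfulSMul k[X] K] :
    Algebra.FormallySmooth k[X] K := by
  let := FractionRing.liftAlgebra k[X] K
  have : Algebra.FormallySmooth k[X] (FractionRing k[X]) := .of_isLocalization (nonZeroDivisors _)
  have : CharZero (FractionRing k[X]) :=
    charZero_of_injective_algebraMap (IsFractionRing.injective k[X] _)
  obtain ⟨ι, v, hv⟩ := exists_isTranscendenceBasis' (FractionRing k[X]) K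
  have := hv.isAlgebraic_field
  have : Algebra.FormallySmooth (FractionRing k[X]) K :=
    .of_algebraicIndependent_of_isSeparable hv.1
  exact .comp _ (FractionRing k[X]) _

variable [Algebra k K]

open Polynomial TensorProduct in
theorem kaehlerDifferential_D_ne_zero [CharZero k] {t : K} (ht : Transcendental k t) :
    KaehlerDifferential.D k K t ≠ 0 := by
  let : Algebra k[X] K := (aeval t).toAlgebra
  have : IsScalarTower k k[X] K := .of_algebraMap_eq fun c => ((aeval t).commutes c).symm
  have : FaithfulSMul k[X] K :=
    (faithfulSMul_iff_algebraMap_injective _ _).2 (transcendental_iff_injective.1 ht)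
  have := formallySmooth_polynomial (k := k) (K := K)
  have hinj : Function.Injective (KaehlerDifferential.mapBaseChange k k[X] K) := by
    rw [injective_iff_map_eq_zero]
    intro x hx
    obtain ⟨y, rfl⟩ := (Algebra.H1Cotangent.exact_δ_mapBaseChange k k[X] K x).1 hx
    rw [Subsingleton.elim y 0, map_zero]
  have hX : (1 : K) ⊗ₜ[k[X]] KaehlerDifferential.D k k[X] X ≠ 0 := fun h0 => by
    simpa using congrArg (TensorProduct.rid k[X] K ∘
      (KaehlerDifferential.polynomialEquiv k).toLinearMap.lTensor K) h0
  have := (map_ne_zero_iff _ hinj).2 hX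
  rwa [KaehlerDifferential.mapBaseChange_tmul, one_smul, KaehlerDifferential.map_D,
    show algebraMap k[X] K X = t from aeval_X t] at this

theorem exists_derivation_ne_zero [CharZero k] {t : K} (ht : Transcendental k t) :
    ∃ D : Derivation k K K, D t ≠ 0 := by
  by_contra! h
  exact kaehlerDifferential_D_ne_zero ht <| (Module.forall_dual_apply_eq_zero_iff K _).1
    fun φ => h (φ.compDer (KaehlerDifferential.D k K))

theorem exists_algebraMap_eq_of_isAlgebraic [IsAlgClosed k] {t : K} (ht : IsAlgebraic k t) :
    ∃ c : k, algebraMap k K c = t :=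
  minpoly.mem_range_of_degree_eq_one k t
    (IsAlgClosed.degree_eq_one_of_irreducible k (minpoly.irreducible ht.isIntegral))

theorem exists_algebraMap_eq_of_forall_derivation [IsAlgClosed k] [CharZero k] {t : K}
    (h : ∀ D : Derivation k K K, D t = 0) : ∃ c : k, algebraMap k K c = t := by
  by_contra hc
  have ht : Transcendental k t := fun halg => hc (exists_algebraMap_eq_of_isAlgebraic halg)
  obtain ⟨D, hD⟩ := exists_derivation_ne_zero ht
  exact hD (h D)

end Derivations

section GenericPoints

open Polynomial in
theorem dvd_of_aeval_eq_zero_of_irreducible {R L : Type*} [CommRing R] [IsDomain R]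
    [UniqueFactorizationMonoid R] [Field L] [Algebra R L] [FaithfulSMul R L] {p g : R[X]}
    (hp : Irreducible p) {s : L} (hps : aeval s p = 0) (hgs : aeval s g = 0) : p ∣ g := by
  classical
  let : NormalizedGCDMonoid R := Classical.arbitrary _
  let := FractionRing.liftAlgebra R L
  let F := FractionRing R
  have hdeg : p.natDegree ≠ 0 := fun hdeg => by
    obtain ⟨r, rfl⟩ := natDegree_eq_zero.1 hdeg
    rw [aeval_C, FaithfulSMul.algebraMap_eq_zero_iff] at hps
    exact hp.ne_zero (by rw [hps, C_0])
  have hprim : p.IsPrimitive := hp.isPrimitive hdeg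
  refine hprim.dvd_of_fraction_map_dvd_fraction_map (K := F) ?_
  have hirr : Irreducible (p.map (algebraMap R F)) :=
    hprim.irreducible_iff_irreducible_map_fraction_map.1 hp
  by_contra hdvd
  obtain ⟨a, b, hab⟩ := hirr.coprime_iff_not_dvd.2 hdvd
  simpa [aeval_map_algebraMap, hps, hgs] using congrArg (aeval s) hab

open MvPolynomial

variable {k : Type*} [Field k]

theorem dvd_of_aeval_eq_zero_of_algebraicIndepOn {σ L : Type*} [Field L] [Algebra k L]
    {f g : MvPolynomial σ k} (hf : Irreducible f) {x : σ → L} {i : σ}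
    (hx : AlgebraicIndepOn k x {i}ᶜ) (hfx : aeval x f = 0) (hgx : aeval x g = 0) : f ∣ g := by
  classical
  let : Algebra (MvPolynomial {j // j ≠ i} k) L :=
    (aeval fun j : {j // j ≠ i} => x j).toAlgebra
  have : FaithfulSMul (MvPolynomial {j // j ≠ i} k) L :=
    (faithfulSMul_iff_algebraMap_injective _ _).2 hx
  have : IsScalarTower k (MvPolynomial {j // j ≠ i} k) L :=
    .of_algebraMap_eq fun c => ((aeval fun j : {j // j ≠ i} => x j).commutes c).symm
  let E : MvPolynomial σ k ≃ₐ[k] Polynomial (MvPolynomial {j // j ≠ i} k) :=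
    (renameEquiv k (Equiv.optionSubtypeNe i).symm).trans (optionEquivLeft k _)
  have hE : ∀ p, Polynomial.aeval (x i) (E p) = aeval x p := fun p => by
    have : ((Polynomial.aeval (x i)).restrictScalars k).comp E.toAlgHom = aeval x := by
      ext j
      by_cases hj : j = i
      · simp [E, hj]
      · simp [E, Equiv.optionSubtypeNe_symm_of_ne hj, RingHom.algebraMap_toAlgebra]
    exact AlgHom.congr_fun this p
  refine (map_dvd_iff E).1 (dvd_of_aeval_eq_zero_of_irreducible (s := x i)
    ((MulEquiv.irreducible_iff E.toMulEquiv).2 hf) ?_ ?_)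
  · rw [hE, hfx]
  · rw [hE, hgx]

theorem transcendental_adjoin_algebraMap {K L : Type*} [Field K] [Field L] [Algebra k K]
    [Algebra k L] [Algebra K L] [IsScalarTower k K L] {t : K} {s : L} (ht : Transcendental k t)
    (hs : Transcendental K s) :
    Transcendental (Algebra.adjoin k {s}) (algebraMap K L t) := by
  have hts := (algebraicIndependent_iff_transcendental.2 ht).sumElim_comp
    (algebraicIndependent_iff_transcendental.2 hs)
  have himage : (![s] ⊕ᵥ algebraMap K L ∘ ![t]) '' {Sum.inr 0}ᶜ = {s} := by
    ext; simp [eq_comm]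
  have := ((AlgebraicIndependent.iff_transcendental_adjoin_image (Sum.inr 0)).1 hts).2
  rwa [himage] at this

theorem algebraicIndepOn_algebraMap_mul_X {σ K : Type*} [Field K] [Algebra k K] {q : σ → K}
    {i j : σ} (hi : q i ≠ 0) (hij : Transcendental k (q j / q i)) :
    AlgebraicIndepOn k (fun a => algebraMap K (RatFunc K) (q a) * RatFunc.X) {j, i} := by
  have hqi : algebraMap K (RatFunc K) (q i) ≠ 0 := (map_ne_zero _).2 hi
  set s := algebraMap K (RatFunc K) (q i) * RatFunc.X with hs
  have hs0 : s ≠ 0 := mul_ne_zero hqi RatFunc.X_ne_zero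
  have hsK : Transcendental K s := fun h => RatFunc.transcendental_X
    (.of_mul (mem_nonZeroDivisors_of_ne_zero hqi) (isAlgebraic_algebraMap _) h)
  refine .insert (algebraicIndependent_unique_type_iff.2
    (hsK.restrictScalars (algebraMap k K).injective)) ?_
  rw [Set.image_singleton, ← hs]
  intro h
  have hsA : IsAlgebraic (Algebra.adjoin k {s}) s :=
    isAlgebraic_algebraMap (⟨s, Algebra.self_mem_adjoin_singleton k s⟩ : Algebra.adjoin k {s})
  refine transcendental_adjoin_algebraMap hij hsK
    (IsAlgebraic.of_mul (mem_nonZeroDivisors_of_ne_zero hs0) hsA ?_)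
  convert! h using 1
  rw [hs, map_div₀]
  field_simp

theorem aeval_smul_of_isHomogeneous {σ S : Type*} [CommSemiring S] [Algebra k S]
    {f : MvPolynomial σ k} {n : ℕ} (hf : f.IsHomogeneous n) (c : S) (q : σ → S) :
    aeval (c • q) f = c ^ n * aeval q f := by
  rw [aeval_def, aeval_def, eval₂_eq, eval₂_eq, Finset.mul_sum]
  refine Finset.sum_congr rfl fun d hd => ?_
  have hdeg : ∑ i ∈ d.support, d i = n := by
    rw [← hf (mem_support_iff.1 hd), Finsupp.weight_apply, Finsupp.sum]
    simp
  rw [← hdeg, ← Finset.prod_pow_eq_pow_sum]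
  simp only [Pi.smul_apply, smul_eq_mul, mul_pow, Finset.prod_mul_distrib]
  ring

theorem dvd_of_aeval_eq_zero_of_transcendental_div {K : Type*} [Field K] [Algebra k K]
    {f g : MvPolynomial (Fin 3) k} (hf : Irreducible f) {m n : ℕ} (hm : f.IsHomogeneous m)
    (hn : g.IsHomogeneous n) {q : Fin 3 → K} {i j : Fin 3} (hi : q i ≠ 0)
    (hij : Transcendental k (q j / q i)) (hfq : aeval q f = 0) (hgq : aeval q g = 0) : f ∣ g := by
  have hne : i ≠ j := by
    rintro rfl
    exact hij (by rw [div_self hi]; exact isAlgebraic_one)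
  obtain ⟨l, hl⟩ : ∃ l : Fin 3, ({l}ᶜ : Set (Fin 3)) = {j, i} := by
    have : ∀ i j : Fin 3, i ≠ j → ∃ l : Fin 3, ∀ a, a ≠ l ↔ a = j ∨ a = i := by decide
    exact (this i j hne).imp fun l hl => Set.ext hl
  have haeval : ∀ {p : MvPolynomial (Fin 3) k} {d : ℕ}, p.IsHomogeneous d → aeval q p = 0 →
      aeval (fun a => algebraMap K (RatFunc K) (q a) * RatFunc.X) p = 0 := fun {p d} hd hp => by
    have := aeval_smul_of_isHomogeneous hd RatFunc.X (algebraMap K (RatFunc K) ∘ q)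
    rw [(aeval_algebraMap_eq_zero_iff (RatFunc K) q p).2 hp, mul_zero] at this
    rw [← this]
    simp only [mul_comm]
    rfl
  exact dvd_of_aeval_eq_zero_of_algebraicIndepOn hf
    (hl ▸ algebraicIndepOn_algebraMap_mul_X hi hij) (haeval hm hfq) (haeval hn hgq)

theorem degree_ne_zero_of_irreducible {σ : Type*} {f : MvPolynomial σ k} (hf : Irreducible f)
    {n : ℕ} (hn : f.IsHomogeneous n) : n ≠ 0 := by
  rintro rfl
  rw [← totalDegree_zero_iff_isHomogeneous, totalDegree_eq_zero_iff_eq_C] at hn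
  have hc : coeff 0 f ≠ 0 := fun hc => hf.ne_zero (by rw [hn, hc, C_0])
  exact hf.not_isUnit (hn ▸ (IsUnit.mk0 _ hc).map C)

section CharZero

variable [CharZero k]

theorem exists_pderiv_ne_zero_of_isHomogeneous {σ : Type*} [Finite σ] {f : MvPolynomial σ k}
    {n : ℕ} (hf : f.IsHomogeneous n) (hn : n ≠ 0) (hf0 : f ≠ 0) : ∃ m, pderiv m f ≠ 0 := by
  cases nonempty_fintype σ
  by_contra! h
  have := hf.sum_X_mul_pderiv
  simp only [h, mul_zero, Finset.sum_const_zero] at this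
  exact smul_ne_zero hn hf0 this.symm

theorem exists_aeval_pderiv_ne_zero {K : Type*} [Field K] [Algebra k K]
    {f : MvPolynomial (Fin 3) k} (hf : Irreducible f) {n : ℕ} (hn : f.IsHomogeneous n)
    {q : Fin 3 → K} {i j : Fin 3} (hi : q i ≠ 0) (hij : Transcendental k (q j / q i))
    (hfq : aeval q f = 0) : ∃ m, aeval q (pderiv m f) ≠ 0 := by
  have hn0 := degree_ne_zero_of_irreducible hf hn
  obtain ⟨m, hm⟩ := exists_pderiv_ne_zero_of_isHomogeneous hn hn0 hf.ne_zero
  refine ⟨m, fun h0 => ?_⟩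
  have hle := totalDegree_le_of_dvd_of_isDomain
    (dvd_of_aeval_eq_zero_of_transcendental_div hf hn hn.pderiv hi hij hfq h0) hm
  rw [hn.totalDegree hf.ne_zero, hn.pderiv.totalDegree hm] at hle
  omega

end CharZero

end GenericPoints

section Conormal

open MvPolynomial

theorem derivation_aeval {R σ A M : Type*} [CommSemiring R] [CommSemiring A] [Algebra R A]
    [AddCommMonoid M] [Module A M] [Module R M] [Fintype σ] (D : Derivation R A M) (q : σ → A)
    (f : MvPolynomial σ R) : D (aeval q f) = ∑ m, aeval q (pderiv m f) • D (q m) := by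
  classical
  induction f using MvPolynomial.induction_on with
  | C a => simp
  | add p r hp hr => simp only [map_add, hp, hr, add_smul, Finset.sum_add_distrib]
  | mul_X p i hp =>
    rw [map_mul, aeval_X, Derivation.leibniz, hp]
    simp [pderiv_X, add_smul, Finset.sum_add_distrib, Finset.smul_sum, smul_smul,
      Pi.single_apply, apply_ite]

variable {k K : Type*} [Field k] [Field K] [Algebra k K]

theorem derivation_eq_zero_of_isAlgebraic [CharZero k] (D : Derivation k K K) {t : K}
    (ht : IsAlgebraic k t) : D t = 0 := by
  have h := D.map_aeval (minpoly k t) t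
  rw [minpoly.aeval, map_zero, eq_comm, smul_eq_mul] at h
  exact (mul_eq_zero.1 h).resolve_left
    ((minpoly.irreducible ht.isIntegral).separable.aeval_derivative_ne_zero (minpoly.aeval k t))

/-- The evident equations of the conormal variety of the plane curve `f = 0` hold at the point `q`
and the line `l`: the curve and the line pass through `q`, and `l` is proportional to the gradient.
Coordinates in an extension field are allowed, since these equations are needed at points of an
ultrapower. -/
structure IsConormal (f : MvPolynomial (Fin 3) k) (q l : Fin 3 → K) : Prop where
  eq_zero : aeval q f = 0
  incident : l ⬝ᵥ q = 0
  parallel : ∀ a b, l a * aeval q (pderiv b f) = l b * aeval q (pderiv a f)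

namespace IsConormal

variable {f : MvPolynomial (Fin 3) k} {q l : Fin 3 → K}

theorem dotProduct_derivation_eq_zero_of_aeval_pderiv_ne_zero (h : IsConormal f q l) {m : Fin 3}
    (hm : aeval q (pderiv m f) ≠ 0) (D : Derivation k K K) : l ⬝ᵥ (D ∘ q) = 0 := by
  refine (mul_eq_zero.1 ?_).resolve_left hm
  calc aeval q (pderiv m f) * (l ⬝ᵥ (D ∘ q))
      = l m * ∑ a, aeval q (pderiv a f) * D (q a) := by
        rw [dotProduct, Finset.mul_sum, Finset.mul_sum]
        exact Finset.sum_congr rfl fun a _ => by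
          rw [Function.comp_apply]
          linear_combination D (q a) * h.parallel a m
    _ = l m * D (aeval q f) := by simp only [derivation_aeval, smul_eq_mul]
    _ = 0 := by rw [h.eq_zero, map_zero, mul_zero]

theorem smul (h : IsConormal f q l) {n : ℕ} (hn : f.IsHomogeneous n) (c : K) :
    IsConormal f (c • q) l where
  eq_zero := by rw [aeval_smul_of_isHomogeneous hn, h.eq_zero, mul_zero]
  incident := by rw [dotProduct_smul, h.incident, smul_zero]
  parallel a b := by
    rw [aeval_smul_of_isHomogeneous hn.pderiv, aeval_smul_of_isHomogeneous hn.pderiv]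
    linear_combination c ^ (n - 1) * h.parallel a b

variable [CharZero k]

/-- The contact form vanishes along a conormal variety: a line tangent to the curve at `q` contains
the velocity of `q`. -/
theorem dotProduct_derivation_eq_zero (h : IsConormal f q l) (hf : Irreducible f) {n : ℕ}
    (hn : f.IsHomogeneous n) (D : Derivation k K K) : l ⬝ᵥ (D ∘ q) = 0 := by
  by_cases hq : q = 0
  · simp [hq, dotProduct]
  obtain ⟨i, hi⟩ := Function.ne_iff.1 hq
  by_cases hconst : ∀ j, IsAlgebraic k (q j / q i)
  · have hDq : D ∘ q = (D (q i) / q i) • q := by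
      funext j
      have hj := D.leibniz (q j / q i) (q i)
      rw [derivation_eq_zero_of_isAlgebraic D (hconst j), div_mul_cancel₀ _ hi] at hj
      simp only [Function.comp_apply, Pi.smul_apply, hj, smul_eq_mul, mul_zero, add_zero]
      ring
    rw [hDq, dotProduct_smul, h.incident, smul_zero]
  · obtain ⟨j, hj⟩ := not_forall.1 hconst
    obtain ⟨m, hm⟩ := exists_aeval_pderiv_ne_zero hf hn hi hj h.eq_zero
    exact h.dotProduct_derivation_eq_zero_of_aeval_pderiv_ne_zero hm D

end IsConormal

end Conormal

section AlternatingForms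

open Module

variable {K V : Type*} [Field K] [AddCommGroup V] [Module K V] [FiniteDimensional K V]
  {A B : LinearMap.BilinForm K V} {W : Submodule K V} {u v x : V}

theorem mem_of_isAlt_of_apply_eq_zero (hA : A.IsAlt) (hW : W ≤ LinearMap.ker A)
    (hdim : finrank K W + 2 = finrank K V) (huv : A u v ≠ 0) (hu : A x u = 0) (hv : A x v = 0) :
    x ∈ W := by
  let φ : V →ₗ[K] K × K := (A.flip u).prod (A.flip v)
  have hvu : A v u ≠ 0 := by rwa [← hA.neg_eq, neg_ne_zero]
  have hφ : LinearMap.range φ = ⊤ := LinearMap.range_eq_top.2 fun y =>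
    ⟨(y.1 / A v u) • v + (y.2 / A u v) • u, by
      simp [φ, hA.self_eq_zero, div_mul_cancel₀ _ hvu, div_mul_cancel₀ _ huv]⟩
  have hrank := φ.finrank_range_add_finrank_ker
  rw [hφ, finrank_top, finrank_prod, finrank_self] at hrank
  have hWφ : W ≤ LinearMap.ker φ := fun w hw => by
    simp [φ, LinearMap.mem_ker.1 (hW hw)]
  rw [Submodule.eq_of_le_of_finrank_eq hWφ (by omega)]
  simp [φ, hu, hv]

theorem ker_eq_of_isAlt (hA : A.IsAlt) (hW : W ≤ LinearMap.ker A)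
    (hdim : finrank K W + 2 = finrank K V) (hA0 : A ≠ 0) : LinearMap.ker A = W := by
  obtain ⟨u, v, huv⟩ : ∃ u v, A u v ≠ 0 := by
    by_contra! h
    exact hA0 (LinearMap.ext₂ h)
  refine le_antisymm (fun x hx => ?_) hW
  rw [LinearMap.mem_ker] at hx
  exact mem_of_isAlt_of_apply_eq_zero hA hW hdim huv (by rw [hx]; rfl) (by rw [hx]; rfl)

theorem exists_eq_smul_of_isAlt (hA : A.IsAlt) (hB : B.IsAlt) (hWA : W ≤ LinearMap.ker A)
    (hWB : W ≤ LinearMap.ker B) (hdim : finrank K W + 2 = finrank K V) (hA0 : A ≠ 0) :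
    ∃ r : K, B = r • A := by
  obtain ⟨u, v, huv⟩ : ∃ u v, A u v ≠ 0 := by
    by_contra! h
    exact hA0 (LinearMap.ext₂ h)
  have hdecomp : ∀ x, ∃ w ∈ W, ∃ s t : K, x = w + (s • u + t • v) := fun x => by
    refine ⟨x - ((A x v / A u v) • u + -(A x u / A u v) • v), ?_, _, _, by abel⟩
    refine mem_of_isAlt_of_apply_eq_zero hA hWA hdim huv ?_ ?_ <;>
      simp [hA.self_eq_zero, ← hA.neg_eq u v, huv]
  have hker : ∀ {C : LinearMap.BilinForm K V}, C.IsAlt → W ≤ LinearMap.ker C → ∀ w ∈ W,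
      C w = 0 ∧ ∀ y, C y w = 0 := fun {C} hC hWC w hw => by
    have : C w = 0 := hWC hw
    exact ⟨this, fun y => by rw [← hC.neg_eq, this]; simp⟩
  refine ⟨B u v / A u v, LinearMap.ext₂ fun x y => ?_⟩
  obtain ⟨w, hw, s, t, rfl⟩ := hdecomp x
  obtain ⟨w', hw', s', t', rfl⟩ := hdecomp y
  simp [hker hA hWA w hw, hker hB hWB w hw, hker hA hWA w' hw', hker hB hWB w' hw',
    hA.self_eq_zero, hB.self_eq_zero, ← hA.neg_eq u v, ← hB.neg_eq u v]
  field_simp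

end AlternatingForms

section CrossProduct

variable {K : Type*} [Field K] {q e l m : Fin 3 → K}

theorem exists_eq_smul_crossProduct (hqe : LinearIndependent K ![q, e]) (hq : l ⬝ᵥ q = 0)
    (he : l ⬝ᵥ e = 0) : ∃ c : K, l = c • (q ⨯₃ e) := by
  have hcross : (q ⨯₃ e) ⨯₃ l = 0 := by
    rw [cross_cross_eq_smul_sub_smul, dotProduct_comm q, dotProduct_comm e, hq, he, zero_smul,
      zero_smul, sub_zero]
  by_contra! hc
  refine crossProduct_ne_zero_iff_linearIndependent.2 ?_ hcross
  rw [LinearIndependent.pair_iff' (crossProduct_ne_zero_iff_linearIndependent.2 hqe)]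
  exact fun c h => hc c h.symm

theorem exists_eq_smul_of_orthogonal (hqe : LinearIndependent K ![q, e]) (hl0 : l ≠ 0)
    (hlq : l ⬝ᵥ q = 0) (hle : l ⬝ᵥ e = 0) (hmq : m ⬝ᵥ q = 0) (hme : m ⬝ᵥ e = 0) :
    ∃ c : K, m = c • l := by
  obtain ⟨a, rfl⟩ := exists_eq_smul_crossProduct hqe hlq hle
  obtain ⟨b, rfl⟩ := exists_eq_smul_crossProduct hqe hmq hme
  exact ⟨b / a, by rw [smul_smul, div_mul_cancel₀ _ (left_ne_zero_of_smul hl0)]⟩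

end CrossProduct

section Epipolar

open Module

variable {K : Type*} [Field K] {N N' N₁ N₂ : Matrix (Fin 3) (Fin 4) K}
  {F G : Matrix (Fin 3) (Fin 3) K} {x : Fin 4 → K} {u v : Fin 3 → K}

/-- The matrices `N₁` and `N₂` have rank three and distinct centres, and `F` is a fundamental matrix
for them, which is expressed by the epipolar constraint: two images of one point of space
correspond under `F`. -/
structure IsEpipolar (N₁ N₂ : Matrix (Fin 3) (Fin 4) K) (F : Matrix (Fin 3) (Fin 3) K) : Prop where
  surjective₁ : Function.Surjective N₁.mulVec
  surjective₂ : Function.Surjective N₂.mulVec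
  disjoint : Disjoint (LinearMap.ker N₁.mulVecLin) (LinearMap.ker N₂.mulVecLin)
  ne_zero : F ≠ 0
  incidence : ∀ x, (N₂ *ᵥ x) ⬝ᵥ (F *ᵥ (N₁ *ᵥ x)) = 0

/-- The vectors that represent the points of the baseline, together with zero. -/
abbrev baselineSpan (N₁ N₂ : Matrix (Fin 3) (Fin 4) K) : Submodule K (Fin 4 → K) :=
  LinearMap.ker N₁.mulVecLin ⊔ LinearMap.ker N₂.mulVecLin

/-- The bilinear form `(x, y) ↦ (N₂ x)ᵀ G (N₁ y)` on the vectors of space. -/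
noncomputable def epipolarForm (N₁ N₂ : Matrix (Fin 3) (Fin 4) K) (G : Matrix (Fin 3) (Fin 3) K) :
    LinearMap.BilinForm K (Fin 4 → K) :=
  Matrix.toBilin' (N₂ᵀ * G * N₁)

theorem epipolarForm_apply (N₁ N₂ : Matrix (Fin 3) (Fin 4) K) (G : Matrix (Fin 3) (Fin 3) K)
    (x y : Fin 4 → K) : epipolarForm N₁ N₂ G x y = (N₂ *ᵥ x) ⬝ᵥ (G *ᵥ (N₁ *ᵥ y)) := by
  rw [epipolarForm, Matrix.toBilin'_apply', Matrix.dotProduct_mulVec, ← Matrix.vecMul_vecMul,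
    ← Matrix.vecMul_vecMul, Matrix.vecMul_transpose, ← Matrix.dotProduct_mulVec,
    ← Matrix.dotProduct_mulVec]

theorem epipolarForm_smul (N₁ N₂ : Matrix (Fin 3) (Fin 4) K) (c : K)
    (G : Matrix (Fin 3) (Fin 3) K) : epipolarForm N₁ N₂ (c • G) = c • epipolarForm N₁ N₂ G := by
  rw [epipolarForm, Matrix.mul_smul, Matrix.smul_mul, map_smul, epipolarForm]

theorem epipolarForm_injective (h₁ : Function.Surjective N₁.mulVec)
    (h₂ : Function.Surjective N₂.mulVec) : Function.Injective (epipolarForm N₁ N₂) := by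
  intro F G hFG
  refine Matrix.ext_of_mulVec_single fun j => dotProduct_eq _ _ fun w => ?_
  obtain ⟨y, hy⟩ := h₁ (Pi.single j 1)
  obtain ⟨x, rfl⟩ := h₂ w
  rw [dotProduct_comm, dotProduct_comm _ (N₂ *ᵥ x), ← hy, ← epipolarForm_apply,
    ← epipolarForm_apply, hFG]

theorem baselineSpan_le_ker_epipolarForm (hG : (epipolarForm N₁ N₂ G).IsAlt) :
    baselineSpan N₁ N₂ ≤ LinearMap.ker (epipolarForm N₁ N₂ G) := by
  refine sup_le (fun x hx => LinearMap.ext fun y => ?_) fun x hx => LinearMap.ext fun y => ?_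
  · rw [LinearMap.mem_ker, Matrix.mulVecLin_apply] at hx
    rw [← hG.neg_eq, epipolarForm_apply, hx, Matrix.mulVec_zero, dotProduct_zero, neg_zero,
      LinearMap.zero_apply]
  · rw [LinearMap.mem_ker, Matrix.mulVecLin_apply] at hx
    rw [epipolarForm_apply, hx, zero_dotProduct, LinearMap.zero_apply]

theorem finrank_ker_mulVecLin (hN : Function.Surjective N.mulVec) :
    finrank K (LinearMap.ker N.mulVecLin) = 1 := by
  have hrank := N.mulVecLin.finrank_range_add_finrank_ker
  rw [LinearMap.range_eq_top.2 hN, finrank_top, finrank_fin_fun, finrank_fin_fun] at hrank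
  omega

namespace IsEpipolar

theorem swap (h : IsEpipolar N₁ N₂ F) : IsEpipolar N₂ N₁ Fᵀ where
  surjective₁ := h.surjective₂
  surjective₂ := h.surjective₁
  disjoint := h.disjoint.symm
  ne_zero := by simpa using h.ne_zero
  incidence x := by
    rw [Matrix.mulVec_transpose, dotProduct_comm, ← Matrix.dotProduct_mulVec, h.incidence]

theorem smul (h : IsEpipolar N₁ N₂ F) {c : K} (hc : c ≠ 0) : IsEpipolar N₁ N₂ (c • F) where
  __ := h
  ne_zero := smul_ne_zero hc h.ne_zero
  incidence x := by rw [Matrix.smul_mulVec, dotProduct_smul, h.incidence, smul_zero]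

theorem isAlt (h : IsEpipolar N₁ N₂ F) : (epipolarForm N₁ N₂ F).IsAlt := fun x => by
  rw [epipolarForm_apply, h.incidence]

theorem epipolarForm_ne_zero (h : IsEpipolar N₁ N₂ F) : epipolarForm N₁ N₂ F ≠ 0 := fun h0 =>
  h.ne_zero <| epipolarForm_injective h.surjective₁ h.surjective₂ <| by
    rw [h0, epipolarForm, Matrix.mul_zero, Matrix.zero_mul, map_zero]

theorem finrank_baselineSpan (h : IsEpipolar N₁ N₂ F) : finrank K (baselineSpan N₁ N₂) = 2 := by
  have hdim := Submodule.finrank_sup_add_finrank_inf_eq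
    (LinearMap.ker N₁.mulVecLin) (LinearMap.ker N₂.mulVecLin)
  rwa [h.disjoint.eq_bot, finrank_bot, finrank_ker_mulVecLin h.surjective₁,
    finrank_ker_mulVecLin h.surjective₂] at hdim

theorem ker_epipolarForm (h : IsEpipolar N₁ N₂ F) :
    LinearMap.ker (epipolarForm N₁ N₂ F) = baselineSpan N₁ N₂ :=
  ker_eq_of_isAlt h.isAlt (baselineSpan_le_ker_epipolarForm h.isAlt)
    (by rw [h.finrank_baselineSpan, finrank_fin_fun]) h.epipolarForm_ne_zero

theorem exists_eq_smul_of_incidence (h : IsEpipolar N₁ N₂ F)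
    (hG : ∀ x, (N₂ *ᵥ x) ⬝ᵥ (G *ᵥ (N₁ *ᵥ x)) = 0) : ∃ c : K, G = c • F := by
  have hGalt : (epipolarForm N₁ N₂ G).IsAlt := fun x => by rw [epipolarForm_apply, hG]
  obtain ⟨c, hc⟩ := exists_eq_smul_of_isAlt h.isAlt hGalt
    (baselineSpan_le_ker_epipolarForm h.isAlt) (baselineSpan_le_ker_epipolarForm hGalt)
    (by rw [h.finrank_baselineSpan, finrank_fin_fun]) h.epipolarForm_ne_zero
  exact ⟨c, epipolarForm_injective h.surjective₁ h.surjective₂ (by rw [hc, epipolarForm_smul])⟩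

theorem vecMul_eq_zero_iff (h : IsEpipolar N₁ N₂ F) :
    (N₂ *ᵥ x) ᵥ* F = 0 ↔ x ∈ baselineSpan N₁ N₂ := by
  rw [← h.ker_epipolarForm, LinearMap.mem_ker, LinearMap.ext_iff, ← dotProduct_eq_zero_iff,
    h.surjective₁.forall]
  simp only [epipolarForm_apply, Matrix.dotProduct_mulVec, LinearMap.zero_apply]

theorem mulVec_eq_zero_iff (h : IsEpipolar N₁ N₂ F) :
    F *ᵥ (N₁ *ᵥ x) = 0 ↔ x ∈ baselineSpan N₁ N₂ := by
  rw [← Matrix.vecMul_transpose, h.swap.vecMul_eq_zero_iff, baselineSpan, sup_comm]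

theorem exists_mem_ker_of_mulVec_eq_zero (h : IsEpipolar N₁ N₂ F) (hu : F *ᵥ u = 0) :
    ∃ b ∈ LinearMap.ker N₂.mulVecLin, N₁ *ᵥ b = u := by
  obtain ⟨x, rfl⟩ := h.surjective₁ u
  obtain ⟨a, ha, b, hb, rfl⟩ := Submodule.mem_sup.1 (h.mulVec_eq_zero_iff.1 hu)
  exact ⟨b, hb, by rw [Matrix.mulVec_add, show N₁ *ᵥ a = 0 from ha, zero_add]⟩

theorem exists_eq_smul_of_mulVec_eq_zero (h : IsEpipolar N₁ N₂ F) (hu : F *ᵥ u = 0)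
    (hv : F *ᵥ v = 0) (hv0 : v ≠ 0) : ∃ c : K, u = c • v := by
  obtain ⟨a, ha, rfl⟩ := h.exists_mem_ker_of_mulVec_eq_zero hu
  obtain ⟨b, hb, rfl⟩ := h.exists_mem_ker_of_mulVec_eq_zero hv
  have hb0 : (⟨b, hb⟩ : LinearMap.ker N₂.mulVecLin) ≠ 0 := fun h0 => hv0 <| by
    rw [show b = 0 from congrArg Subtype.val h0, Matrix.mulVec_zero]
  obtain ⟨c, hc⟩ :=
    (finrank_eq_one_iff_of_nonzero' _ hb0).1 (finrank_ker_mulVecLin h.surjective₂) ⟨a, ha⟩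
  exact ⟨c, by rw [← Matrix.mulVec_smul, show a = c • b from congrArg Subtype.val hc.symm]⟩

end IsEpipolar

end Epipolar

section EpipolarTangent

open Module

variable {k K : Type*} [Field k] [Field K] [Algebra k K] {f f₁ f₂ : MvPolynomial (Fin 3) k}
  {N N' N₁ N₂ : Matrix (Fin 3) (Fin 4) K} {F : Matrix (Fin 3) (Fin 3) K} {x : Fin 4 → K}

/-- At the image of `x` under `N`, the curve `f = 0` has a tangent line through the epipole, which
is the image of the centre of `N'`. This is the condition that `x` is a space tangency point, seen
in one of the two planes. -/
def HasEpipolarTangent (f : MvPolynomial (Fin 3) k) (N N' : Matrix (Fin 3) (Fin 4) K)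
    (x : Fin 4 → K) : Prop :=
  ∃ l ≠ 0, IsConormal f (N *ᵥ x) l ∧ ∀ b, N' *ᵥ b = 0 → l ⬝ᵥ (N *ᵥ b) = 0

theorem derivation_dotProduct {R A m : Type*} [CommSemiring R] [CommSemiring A] [Algebra R A]
    [Fintype m] (D : Derivation R A A) (u v : m → A) :
    D (u ⬝ᵥ v) = (D ∘ u) ⬝ᵥ v + u ⬝ᵥ (D ∘ v) := by
  simp only [dotProduct, map_sum, Derivation.leibniz, smul_eq_mul, Function.comp_apply,
    ← Finset.sum_add_distrib]
  exact Finset.sum_congr rfl fun i _ => by ring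

theorem derivation_comp_mulVec {R A m n : Type*} [CommSemiring R] [CommSemiring A] [Algebra R A]
    [Fintype n] (D : Derivation R A A) (M : Matrix m n A) (v : n → A) :
    D ∘ (M *ᵥ v) = M.map D *ᵥ v + M *ᵥ (D ∘ v) :=
  funext fun i => derivation_dotProduct D (M i) v

theorem linearIndependent_mulVec_of_notMem_baselineSpan (hx : x ∉ baselineSpan N N')
    {b : Fin 4 → K} (hb : N' *ᵥ b = 0) (hNb : N *ᵥ b ≠ 0) :
    LinearIndependent K ![N *ᵥ x, N *ᵥ b] := by
  rw [LinearIndependent.pair_symm_iff, LinearIndependent.pair_iff' hNb]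
  intro c hc
  refine hx (Submodule.mem_sup.2 ⟨x - c • b, ?_, c • b, Submodule.smul_mem _ c hb, by abel⟩)
  rw [LinearMap.mem_ker, Matrix.mulVecLin_apply, Matrix.mulVec_sub, Matrix.mulVec_smul, hc,
    sub_self]

namespace IsEpipolar

theorem exists_vecMul_eq_smul (h : IsEpipolar N₁ N₂ F) (hx : x ∉ baselineSpan N₁ N₂)
    {l : Fin 3 → K} (hl0 : l ≠ 0) (hl : l ⬝ᵥ (N₁ *ᵥ x) = 0)
    (hle : ∀ b, N₂ *ᵥ b = 0 → l ⬝ᵥ (N₁ *ᵥ b) = 0) : ∃ c : K, (N₂ *ᵥ x) ᵥ* F = c • l := by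
  obtain ⟨b, hb, hb0⟩ := (LinearMap.ker N₂.mulVecLin).exists_mem_ne_zero_of_ne_bot fun h0 => by
    have hdim := finrank_ker_mulVecLin h.surjective₂
    rw [h0, finrank_bot] at hdim
    exact zero_ne_one hdim
  have hNb : N₁ *ᵥ b ≠ 0 := fun h0 => hb0 (Submodule.disjoint_def.1 h.disjoint b h0 hb)
  refine exists_eq_smul_of_orthogonal (linearIndependent_mulVec_of_notMem_baselineSpan hx hb hNb)
    hl0 hl (hle b hb) ?_ ?_
  · rw [← Matrix.dotProduct_mulVec, h.incidence]
  · rw [← Matrix.dotProduct_mulVec,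
      h.mulVec_eq_zero_iff.2 (Submodule.mem_sup_right hb), dotProduct_zero]

variable [CharZero k]

theorem vecMul_dotProduct_derivation_eq_zero (h : IsEpipolar N₁ N₂ F) (hf : Irreducible f) {n : ℕ}
    (hn : f.IsHomogeneous n) (hx : x ∈ baselineSpan N₁ N₂ ∨ HasEpipolarTangent f N₁ N₂ x)
    (D : Derivation k K K) : ((N₂ *ᵥ x) ᵥ* F) ⬝ᵥ (D ∘ (N₁ *ᵥ x)) = 0 := by
  by_cases hxb : x ∈ baselineSpan N₁ N₂
  · rw [h.vecMul_eq_zero_iff.2 hxb, zero_dotProduct]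
  obtain ⟨l, hl0, hl, hle⟩ := hx.resolve_left hxb
  obtain ⟨c, hc⟩ := h.exists_vecMul_eq_smul hxb hl0 hl.incident hle
  rw [hc, smul_dotProduct, hl.dotProduct_derivation_eq_zero hf hn, smul_zero]

/-- Differentiating the epipolar constraint at `x` leaves only the term with the derivative of `F`,
because both images of `x` move along their epipolar lines. -/
theorem epipolarForm_map_derivation_eq_zero (h : IsEpipolar N₁ N₂ F) (hf₁ : Irreducible f₁)
    (hf₂ : Irreducible f₂) {n₁ n₂ : ℕ} (hn₁ : f₁.IsHomogeneous n₁) (hn₂ : f₂.IsHomogeneous n₂)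
    (hx : x ∈ baselineSpan N₁ N₂ ∨ HasEpipolarTangent f₁ N₁ N₂ x ∧ HasEpipolarTangent f₂ N₂ N₁ x)
    (D : Derivation k K K) : epipolarForm N₁ N₂ (F.map D) x x = 0 := by
  have hq₁ := h.vecMul_dotProduct_derivation_eq_zero hf₁ hn₁ (hx.imp_right And.left) D
  have hq₂ := h.swap.vecMul_dotProduct_derivation_eq_zero hf₂ hn₂
    (hx.imp (fun hb => by rwa [baselineSpan, sup_comm]) And.right) D
  have hD : D ((N₂ *ᵥ x) ⬝ᵥ (F *ᵥ (N₁ *ᵥ x))) = 0 := by rw [h.incidence, map_zero]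
  rwa [derivation_dotProduct, derivation_comp_mulVec D F, dotProduct_add,
    Matrix.dotProduct_mulVec _ F (D ∘ _), hq₁, dotProduct_comm (D ∘ _), ← Matrix.vecMul_transpose,
    hq₂, zero_add, add_zero, ← epipolarForm_apply] at hD

end IsEpipolar

theorem IsEpipolar.exists_epipolarForm_map_derivation_ne_zero (h : IsEpipolar N₁ N₂ F)
    (D : Derivation k K K) {i j a b : Fin 3} (hij : F i j = 1) (hab : D (F a b) ≠ 0) :
    ∃ x, epipolarForm N₁ N₂ (F.map D) x x ≠ 0 := by
  by_contra! h0
  obtain ⟨c, hc⟩ := h.exists_eq_smul_of_incidence fun x => by rw [← epipolarForm_apply, h0]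
  have hc0 : c = 0 := by
    have := congrFun₂ hc i j
    rwa [Matrix.map_apply, Matrix.smul_apply, hij, D.map_one_eq_zero, smul_eq_mul, mul_one,
      eq_comm] at this
  have := congrFun₂ hc a b
  rw [hc0, zero_smul] at this
  exact hab this

end EpipolarTangent

section Ultrapower

open Filter Germ

variable {α : Type*} (U : Ultrafilter α) {k : Type*} [Field k]

/-- The ultrapower of the field `k` along `U`: sequences modulo equality `U`-almost everywhere. -/
abbrev Ultrapower (k : Type*) : Type _ :=
  Germ (U : Filter α) k

noncomputable instance : Algebra k (Ultrapower U k) where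
  algebraMap := (coeRingHom (U : Filter α)).comp (algebraMap k (α → k))
  commutes' _ _ := mul_comm _ _
  smul_def' _ x := x.inductionOn fun _ => congrArg ofFun (funext fun _ => smul_eq_mul ..)

/-- The class of a sequence in the ultrapower, thought of as its limit. -/
noncomputable def ultralimit : (α → k) →ₐ[k] Ultrapower U k where
  __ := coeRingHom (U : Filter α)
  commutes' _ := rfl

/-- The coordinatewise ultralimit of a sequence of vectors. -/
noncomputable def vecLim {ι : Type*} (v : α → ι → k) : ι → Ultrapower U k :=
  fun i => ultralimit U fun n => v n i

/-- The entrywise ultralimit of a sequence of matrices. -/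
noncomputable def matLim {ι κ : Type*} (M : α → Matrix ι κ k) : Matrix ι κ (Ultrapower U k) :=
  Matrix.of fun i j => ultralimit U fun n => M n i j

variable {U} {ι κ : Type*}

theorem ultralimit_eq_iff {x y : α → k} :
    ultralimit U x = ultralimit U y ↔ ∀ᶠ n in U, x n = y n :=
  Germ.coe_eq

theorem ultralimit_eq_zero_iff {x : α → k} : ultralimit U x = 0 ↔ ∀ᶠ n in U, x n = 0 := by
  rw [← map_zero (ultralimit U), ultralimit_eq_iff]
  rfl

theorem vecLim_eq_iff [Finite ι] {v w : α → ι → k} :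
    vecLim U v = vecLim U w ↔ ∀ᶠ n in U, v n = w n := by
  simp only [funext_iff, eventually_all]
  exact forall_congr' fun i => ultralimit_eq_iff

theorem vecLim_eq_zero_iff [Finite ι] {v : α → ι → k} :
    vecLim U v = 0 ↔ ∀ᶠ n in U, v n = 0 :=
  vecLim_eq_iff (w := 0)

theorem matLim_eq_iff [Finite ι] [Finite κ] {M M' : α → Matrix ι κ k} :
    matLim U M = matLim U M' ↔ ∀ᶠ n in U, M n = M' n := by
  simp only [← Matrix.ext_iff, eventually_all]
  exact forall₂_congr fun i j => ultralimit_eq_iff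

theorem matLim_eq_zero_iff [Finite ι] [Finite κ] {M : α → Matrix ι κ k} :
    matLim U M = 0 ↔ ∀ᶠ n in U, M n = 0 :=
  matLim_eq_iff (M' := 0)

theorem ultralimit_surjective : Function.Surjective (ultralimit U : (α → k) → Ultrapower U k) :=
  fun x => x.inductionOn fun v => ⟨v, rfl⟩

theorem vecLim_surjective : Function.Surjective (vecLim U : (α → ι → k) → ι → Ultrapower U k) :=
  fun x => by
    choose v hv using fun i => ultralimit_surjective (x i)
    exact ⟨fun n i => v i n, funext hv⟩

theorem matLim_surjective :
    Function.Surjective (matLim U : (α → Matrix ι κ k) → Matrix ι κ (Ultrapower U k)) :=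
  fun M => by
    choose A hA using fun i j => ultralimit_surjective (M i j)
    exact ⟨fun n => Matrix.of fun i j => A i j n, Matrix.ext hA⟩

theorem vecLim_add (v w : α → ι → k) : vecLim U v + vecLim U w = vecLim U (v + w) :=
  rfl

theorem vecLim_dotProduct_vecLim [Fintype ι] (v w : α → ι → k) :
    vecLim U v ⬝ᵥ vecLim U w = ultralimit U fun n => v n ⬝ᵥ w n := by
  simp only [dotProduct, vecLim, ← map_mul, ← map_sum]
  congr 1
  ext n
  simp only [Finset.sum_apply, Pi.mul_apply]

theorem matLim_mulVec_vecLim [Fintype κ] (M : α → Matrix ι κ k) (v : α → κ → k) :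
    matLim U M *ᵥ vecLim U v = vecLim U fun n => M n *ᵥ v n :=
  funext fun i => vecLim_dotProduct_vecLim (fun n => M n i) v

theorem aeval_vecLim (v : α → ι → k) (f : MvPolynomial ι k) :
    MvPolynomial.aeval (vecLim U v) f = ultralimit U fun n => MvPolynomial.aeval (v n) f := by
  let w : ι → α → k := fun i n => v n i
  have hw : ∀ n, MvPolynomial.aeval w f n = MvPolynomial.aeval (v n) f := fun n =>
    MvPolynomial.comp_aeval_apply w (Pi.evalAlgHom k (fun _ : α => k) n) f
  rw [← funext hw]
  exact (MvPolynomial.comp_aeval_apply w (ultralimit U) f).symm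

end Ultrapower

section UltrapowerOfViews

open Filter

variable {α : Type*} {U : Ultrafilter α} {k : Type*} [Field k]
  {N N' N₁ N₂ : α → Matrix (Fin 3) (Fin 4) k}

theorem isConormal_vecLim {f : MvPolynomial (Fin 3) k} {q l : α → Fin 3 → k}
    (h : ∀ᶠ n in U, IsConormal f (q n) (l n)) : IsConormal f (vecLim U q) (vecLim U l) where
  eq_zero := by
    rw [aeval_vecLim, ultralimit_eq_zero_iff]
    exact h.mono fun n hn => hn.eq_zero
  incident := by
    rw [vecLim_dotProduct_vecLim, ultralimit_eq_zero_iff]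
    exact h.mono fun n hn => hn.incident
  parallel a b := by
    simp only [aeval_vecLim, vecLim, ← map_mul]
    exact ultralimit_eq_iff.2 (h.mono fun n hn => hn.parallel a b)

theorem hasEpipolarTangent_vecLim {f : MvPolynomial (Fin 3) k} {x : α → Fin 4 → k}
    (h : ∀ᶠ n in U, HasEpipolarTangent f (N n) (N' n) (x n)) :
    HasEpipolarTangent f (matLim U N) (matLim U N') (vecLim U x) := by
  obtain ⟨l, hl⟩ := skolem.1 h
  refine ⟨vecLim U l, ?_, ?_, fun b hb => ?_⟩
  · rw [Ne, vecLim_eq_zero_iff, ← Ultrafilter.eventually_not]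
    exact hl.mono fun n hn => hn.1
  · rw [matLim_mulVec_vecLim]
    exact isConormal_vecLim (hl.mono fun n hn => hn.2.1)
  · obtain ⟨b, rfl⟩ := vecLim_surjective b
    rw [matLim_mulVec_vecLim, vecLim_eq_zero_iff] at hb
    rw [matLim_mulVec_vecLim, vecLim_dotProduct_vecLim, ultralimit_eq_zero_iff]
    filter_upwards [hl, hb] with n hn hbn
    exact hn.2.2 _ hbn

theorem vecLim_mem_ker_mulVecLin {v : α → Fin 4 → k} :
    vecLim U v ∈ LinearMap.ker (matLim U N).mulVecLin ↔
      ∀ᶠ n in U, v n ∈ LinearMap.ker (N n).mulVecLin := by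
  rw [LinearMap.mem_ker, Matrix.mulVecLin_apply, matLim_mulVec_vecLim, vecLim_eq_zero_iff]
  rfl

theorem vecLim_mem_baselineSpan {x : α → Fin 4 → k}
    (h : ∀ᶠ n in U, x n ∈ baselineSpan (N₁ n) (N₂ n)) :
    vecLim U x ∈ baselineSpan (matLim U N₁) (matLim U N₂) := by
  obtain ⟨a, ha⟩ := skolem.1 (h.mono fun n hn => Submodule.mem_sup'.1 hn)
  obtain ⟨b, hab⟩ := skolem.1 ha
  have hx : vecLim U x = vecLim U (fun n => (a n : Fin 4 → k)) + vecLim U fun n => (b n : _) := by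
    rw [vecLim_add, vecLim_eq_iff]
    exact hab.mono fun n hn => hn.symm
  rw [hx]
  exact Submodule.add_mem_sup (vecLim_mem_ker_mulVecLin.2 (.of_forall fun n => (a n).2))
    (vecLim_mem_ker_mulVecLin.2 (.of_forall fun n => (b n).2))

theorem matLim_mulVec_surjective (h : ∀ n, Function.Surjective (N n).mulVec) :
    Function.Surjective (matLim U N).mulVec := fun w => by
  obtain ⟨w, rfl⟩ := vecLim_surjective w
  choose x hx using fun n => h n (w n)
  exact ⟨vecLim U x, by rw [matLim_mulVec_vecLim, funext hx]⟩

theorem isEpipolar_matLim {F : α → Matrix (Fin 3) (Fin 3) k}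
    (h : ∀ n, IsEpipolar (N₁ n) (N₂ n) (F n)) :
    IsEpipolar (matLim U N₁) (matLim U N₂) (matLim U F) where
  surjective₁ := matLim_mulVec_surjective fun n => (h n).surjective₁
  surjective₂ := matLim_mulVec_surjective fun n => (h n).surjective₂
  disjoint := by
    refine Submodule.disjoint_def.2 fun x hx₁ hx₂ => ?_
    obtain ⟨x, rfl⟩ := vecLim_surjective x
    rw [vecLim_mem_ker_mulVecLin] at hx₁ hx₂
    rw [vecLim_eq_zero_iff]
    filter_upwards [hx₁, hx₂] with n hn₁ hn₂
    exact Submodule.disjoint_def.1 (h n).disjoint _ hn₁ hn₂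
  ne_zero := by
    rw [Ne, matLim_eq_zero_iff, ← Ultrafilter.eventually_not]
    exact .of_forall fun n => (h n).ne_zero
  incidence x := by
    obtain ⟨x, rfl⟩ := vecLim_surjective x
    simp only [matLim_mulVec_vecLim, vecLim_dotProduct_vecLim, (h _).incidence]
    exact map_zero (ultralimit U)

theorem epipolarForm_matLim (G : α → Matrix (Fin 3) (Fin 3) k) (x y : α → Fin 4 → k) :
    epipolarForm (matLim U N₁) (matLim U N₂) (matLim U G) (vecLim U x) (vecLim U y) =
      ultralimit U fun n => epipolarForm (N₁ n) (N₂ n) (G n) (x n) (y n) := by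
  simp only [epipolarForm_apply, matLim_mulVec_vecLim, vecLim_dotProduct_vecLim]

end UltrapowerOfViews

section LimitQuadric

open Filter

variable {α : Type*} {U : Ultrafilter α} {k : Type*} [Field k]

theorem exists_seq_of_not_eventually_forall {β : Type*} [Nonempty β] {p : α → β → Prop}
    (h : ¬ ∀ᶠ n in U, ∀ x, p n x) : ∃ x : α → β, ∀ᶠ n in U, ¬ p n (x n) := by
  rw [← Ultrafilter.eventually_not] at h
  exact skolem.1 (h.mono fun n hn => not_forall.1 hn)

variable [CharZero k] {N₁ N₂ : α → Matrix (Fin 3) (Fin 4) k} {F : α → Matrix (Fin 3) (Fin 3) k}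
  {f₁ f₂ : MvPolynomial (Fin 3) k} {n₁ n₂ : ℕ}

/-- If the limit of a family of fundamental matrices can be deformed, then the baseline and the
space tangency points of almost all members lie on quadrics: approximate the quadric over the
ultrapower that is given by the derivative of the limit. -/
theorem eventually_exists_quadraticForm (h : ∀ n, IsEpipolar (N₁ n) (N₂ n) (F n))
    (hf₁ : Irreducible f₁) (hf₂ : Irreducible f₂) (hn₁ : f₁.IsHomogeneous n₁)
    (hn₂ : f₂.IsHomogeneous n₂) {c : Ultrapower U k} (hc : c ≠ 0) {i j a b : Fin 3}
    (hij : (c • matLim U F) i j = 1) (D : Derivation k (Ultrapower U k) (Ultrapower U k))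
    (hab : D ((c • matLim U F) a b) ≠ 0) :
    ∀ᶠ n in U, ∃ B : QuadraticForm k (Fin 4 → k), B ≠ 0 ∧ ∀ x,
      x ∈ baselineSpan (N₁ n) (N₂ n) ∨ HasEpipolarTangent f₁ (N₁ n) (N₂ n) x ∧
        HasEpipolarTangent f₂ (N₂ n) (N₁ n) x → B x = 0 := by
  have hlim := (isEpipolar_matLim (U := U) h).smul hc
  obtain ⟨G, hG⟩ := matLim_surjective ((c • matLim U F).map D)
  let B : α → QuadraticForm k (Fin 4 → k) := fun n =>
    (epipolarForm (N₁ n) (N₂ n) (G n)).toQuadraticMap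
  have hB : ∀ x : α → Fin 4 → k, epipolarForm (matLim U N₁) (matLim U N₂)
      ((c • matLim U F).map D) (vecLim U x) (vecLim U x) = ultralimit U fun n => B n (x n) :=
    fun x => by rw [← hG, epipolarForm_matLim]; rfl
  have hB0 : ∀ᶠ n in U, B n ≠ 0 := by
    obtain ⟨x, hx⟩ := hlim.exists_epipolarForm_map_derivation_ne_zero D hij hab
    obtain ⟨x, rfl⟩ := vecLim_surjective x
    rw [hB, Ne, ultralimit_eq_zero_iff, ← Ultrafilter.eventually_not] at hx
    exact hx.mono fun n hn h0 => hn (by rw [h0]; rfl)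
  refine (hB0.and ?_).mono fun n hn => ⟨B n, hn⟩
  by_contra hfail
  obtain ⟨x, hx⟩ := exists_seq_of_not_eventually_forall hfail
  simp only [Classical.not_imp, eventually_and, Ultrafilter.eventually_or] at hx
  obtain ⟨hmem, hne⟩ := hx
  refine Ultrafilter.eventually_not.1 hne (ultralimit_eq_zero_iff.1 ?_)
  rw [← hB]
  exact hlim.epipolarForm_map_derivation_eq_zero hf₁ hf₂ hn₁ hn₂ (hmem.imp vecLim_mem_baselineSpan
    (And.imp hasEpipolarTangent_vecLim hasEpipolarTangent_vecLim)) D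

end LimitQuadric

section Deformation

open Filter

variable {α : Type*} {U : Ultrafilter α} {k : Type*} [Field k]

theorem eventually_ne_of_injective {β : Type*} (hU : (U : Filter α) ≤ cofinite) {p : α → β}
    (hp : Function.Injective p) (b : β) : ∀ᶠ n in U, p n ≠ b :=
  hp.tendsto_cofinite.mono_left hU (Set.finite_singleton b).compl_mem_cofinite

theorem eq_mk_of_rep_eq_smul {V : Type*} [AddCommGroup V] [Module k V] {p : ℙ k V} {v : V}
    (hv : v ≠ 0) {r : k} (h : p.rep = r • v) : p = .mk k v hv := by
  rw [← p.mk_rep]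
  exact (Projectivization.mk_eq_mk_iff' ..).2 ⟨r, h.symm⟩

variable {m n : Type*} [Finite m] [Finite n] {p : α → ℙ k (Matrix m n k)}

theorem exists_eventually_rep_eq_smul {c : Ultrapower U k} (hc : c ≠ 0) {A : Matrix m n k}
    (hA : c • matLim U (fun a => (p a).rep) = A.map (algebraMap k (Ultrapower U k))) :
    ∃ r : α → k, ∀ᶠ a in U, (p a).rep = r a • A := by
  obtain ⟨r, hr⟩ := ultralimit_surjective c⁻¹
  refine ⟨r, matLim_eq_iff.1 ?_⟩
  rw [← inv_smul_smul₀ hc (matLim U _), hA, ← hr]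
  rfl

theorem smul_matLim_rep_ne_map_algebraMap (hU : (U : Filter α) ≤ cofinite)
    (hp : Function.Injective p) {c : Ultrapower U k} (hc : c ≠ 0) (A : Matrix m n k) :
    c • matLim U (fun a => (p a).rep) ≠ A.map (algebraMap k (Ultrapower U k)) := by
  intro hA
  obtain ⟨r, hr⟩ := exists_eventually_rep_eq_smul hc hA
  have hA0 : A ≠ 0 := by
    rintro rfl
    obtain ⟨a, ha⟩ := hr.exists
    exact (p a).rep_nonzero (ha.trans (smul_zero _))
  obtain ⟨a, ha, hne⟩ := (hr.and (eventually_ne_of_injective hU hp (.mk k A hA0))).exists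
  exact hne (eq_mk_of_rep_eq_smul hA0 ha)

/-- A non-constant family has a limit that is not defined over `k`, so some derivation moves it. -/
theorem exists_derivation_smul_matLim_rep_ne_zero [IsAlgClosed k] [CharZero k]
    (hU : (U : Filter α) ≤ cofinite) (hp : Function.Injective p) :
    ∃ c : Ultrapower U k, c ≠ 0 ∧ ∃ i j, (c • matLim U fun a => (p a).rep) i j = 1 ∧
      ∃ (D : Derivation k (Ultrapower U k) (Ultrapower U k)) (a : m) (b : n),
        D ((c • matLim U fun a => (p a).rep) a b) ≠ 0 := by
  have hF0 : matLim U (fun a => (p a).rep) ≠ 0 := by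
    rw [Ne, matLim_eq_zero_iff, ← Ultrafilter.eventually_not]
    exact .of_forall fun a => (p a).rep_nonzero
  obtain ⟨i, j, hij⟩ : ∃ i j, matLim U (fun a => (p a).rep) i j ≠ 0 := by
    by_contra! h0
    exact hF0 (Matrix.ext h0)
  refine ⟨_, inv_ne_zero hij, i, j, inv_mul_cancel₀ hij, ?_⟩
  by_contra! hconst
  choose A hA using fun a b =>
    exists_algebraMap_eq_of_forall_derivation fun D => hconst D a b
  exact smul_matLim_rep_ne_map_algebraMap hU hp (inv_ne_zero hij) (Matrix.of A)
    (Matrix.ext fun a b => (hA a b).symm)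

end Deformation

section FundamentalMatrix

theorem sum_mulVec_mul_det {R : Type*} [CommRing R] (M : Matrix (Fin 3) (Fin 4) R)
    (r s x : Fin 4 → R) :
    ∑ i, (M *ᵥ x) i * (Matrix.of ![M (i + 1), M (i + 2), r, s]).det =
      (r ⬝ᵥ x) * (Matrix.of ![M 0, M 1, M 2, s]).det -
        (s ⬝ᵥ x) * (Matrix.of ![M 0, M 1, M 2, r]).det := by
  simp only [Fin.sum_univ_three, Matrix.mulVec, dotProduct, Fin.sum_univ_four,
    Matrix.det_succ_row_zero, Matrix.det_fin_zero]
  simp [Fin.sum_univ_succ, Fin.succAbove, Matrix.submatrix]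
  ring

/-- Expanding along both projections, each term `(N₁ x)ᵢ (N₁ x)ⱼ` occurs twice, with opposite
signs. -/
theorem dotProduct_fundamentalMatrix_mulVec (N₁ N₂ : Matrix (Fin 3) (Fin 4) ℂ) (x : Fin 4 → ℂ) :
    (N₂ *ᵥ x) ⬝ᵥ (fundamentalMatrix N₁ N₂ *ᵥ (N₁ *ᵥ x)) = 0 := by
  have hrow : ∀ j, ((N₂ *ᵥ x) ᵥ* fundamentalMatrix N₁ N₂) j =
      (N₁ *ᵥ x) (j + 1) * (Matrix.of ![N₂ 0, N₂ 1, N₂ 2, N₁ (j + 2)]).det -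
        (N₁ *ᵥ x) (j + 2) * (Matrix.of ![N₂ 0, N₂ 1, N₂ 2, N₁ (j + 1)]).det :=
    fun j => sum_mulVec_mul_det N₂ (N₁ (j + 1)) (N₁ (j + 2)) x
  rw [Matrix.dotProduct_mulVec, dotProduct, Fin.sum_univ_three, hrow, hrow, hrow]
  simp only [zero_add, Fin.reduceAdd]
  ring

end FundamentalMatrix

section Realization

open Filter MvPolynomial

variable {f f₁ f₂ : MvPolynomial (Fin 3) ℂ} {n n₁ n₂ : ℕ} {N N' N₁ N₂ : Matrix (Fin 3) (Fin 4) ℂ}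
  {O P : P3} {e q l : P2} {T T' : P2 × P8 × P2}

theorem IsTangentAt.isConormal (h : IsTangentAt f q l) (hf : f.IsHomogeneous n) :
    IsConormal f q.rep l.rep where
  eq_zero := by
    have := h (rename Sum.inl f) fun u w _ _ hu _ => by simpa [eval_rename] using hu
    simpa [eval_rename, aeval_eq_eval] using this
  incident := by
    have := h (∑ i, X (Sum.inr i) * X (Sum.inl i)) fun u w _ _ hu ⟨c, hc⟩ => by
      have heuler := congrArg (eval u) hf.sum_X_mul_pderiv
      simp only [map_sum, map_mul, eval_X, map_nsmul, hu, smul_zero] at heuler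
      simp only [map_sum, map_mul, eval_X, Sum.elim_inl, Sum.elim_inr, hc, Pi.smul_apply,
        gradient, smul_eq_mul]
      rw [← mul_zero c, ← heuler, Finset.mul_sum]
      exact Finset.sum_congr rfl fun i _ => by ring
    simpa [dotProduct] using this
  parallel a b := by
    have := h (X (Sum.inr a) * rename Sum.inl (pderiv b f) -
        X (Sum.inr b) * rename Sum.inl (pderiv a f)) fun u w _ _ _ ⟨c, hc⟩ => by
      simp only [map_sub, map_mul, eval_X, Sum.elim_inr, eval_rename, Sum.elim_comp_inl, hc,
        Pi.smul_apply, gradient, smul_eq_mul]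
      ring
    simpa [eval_rename, aeval_eq_eval, sub_eq_zero] using this

namespace IsProjectionFrom

theorem mulVec_surjective (h : IsProjectionFrom N O) : Function.Surjective N.mulVec := by
  have hrange : LinearMap.range N.mulVecLin = ⊤ := Submodule.eq_top_of_finrank_eq <| by
    rw [← Matrix.rank, h.1, Module.finrank_fin_fun]
  exact LinearMap.range_eq_top.1 hrange

theorem exists_eq_smul_rep (h : IsProjectionFrom N O) {b : Fin 4 → ℂ} (hb : N *ᵥ b = 0) :
    ∃ c : ℂ, b = c • O.rep := by
  have hO : (⟨O.rep, h.2⟩ : LinearMap.ker N.mulVecLin) ≠ 0 := fun h0 =>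
    O.rep_nonzero (congrArg Subtype.val h0)
  obtain ⟨c, hc⟩ := (finrank_eq_one_iff_of_nonzero' _ hO).1
    (finrank_ker_mulVecLin h.mulVec_surjective) ⟨b, hb⟩
  exact ⟨c, (congrArg Subtype.val hc).symm⟩

theorem disjoint_ker_mulVecLin (h : IsProjectionFrom N' O) (he : ProjectsTo N O e) :
    Disjoint (LinearMap.ker N.mulVecLin) (LinearMap.ker N'.mulVecLin) := by
  refine Submodule.disjoint_def.2 fun x hx hx' => ?_
  obtain ⟨c, rfl⟩ := h.exists_eq_smul_rep hx'
  obtain ⟨d, hd, hO⟩ := he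
  rw [LinearMap.mem_ker, Matrix.mulVecLin_apply, Matrix.mulVec_smul, hO] at hx
  rw [(smul_eq_zero.1 hx).resolve_right (smul_ne_zero hd e.rep_nonzero), zero_smul]

theorem hasEpipolarTangent (h : IsProjectionFrom N' O) (he : ProjectsTo N O e)
    (hn : f.IsHomogeneous n) (hP : ∃ q ∈ tangencyPoints f e, ProjectsTo N P q) :
    HasEpipolarTangent f N N' P.rep := by
  obtain ⟨q, ⟨l, hl, hle⟩, c, -, hq⟩ := hP
  obtain ⟨d, -, hO⟩ := he
  refine ⟨l.rep, l.rep_nonzero, hq ▸ (hl.isConormal hn).smul hn c, fun b hb => ?_⟩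
  obtain ⟨a, rfl⟩ := h.exists_eq_smul_rep hb
  rw [Matrix.mulVec_smul, hO, dotProduct_smul, dotProduct_smul, hle, smul_zero, smul_zero]

end IsProjectionFrom

namespace Realizes

theorem isEpipolar (h : Realizes N₁ N₂ T) : IsEpipolar N₁ N₂ T.2.1.rep := by
  obtain ⟨⟨c, hc, hF⟩, C₁, C₂, h₁, h₂, he₁, -⟩ := h
  refine ⟨h₁.mulVec_surjective, h₂.mulVec_surjective, h₂.disjoint_ker_mulVecLin he₁,
    T.2.1.rep_nonzero, fun x => ?_⟩
  have hx := dotProduct_fundamentalMatrix_mulVec N₁ N₂ x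
  rw [hF, Matrix.smul_mulVec, dotProduct_smul] at hx
  exact (smul_eq_zero.1 hx).resolve_left hc

theorem mulVec_epipole_eq_zero (h : Realizes N₁ N₂ T) : T.2.1.rep *ᵥ T.1.rep = 0 := by
  have hepi := h.isEpipolar
  obtain ⟨-, C₁, C₂, -, h₂, ⟨c, hc, he₁⟩, -⟩ := h
  have hF := hepi.mulVec_eq_zero_iff.2 (Submodule.mem_sup_right h₂.2)
  rw [he₁, Matrix.mulVec_smul] at hF
  exact (smul_eq_zero.1 hF).resolve_left hc

theorem transpose_mulVec_epipole_eq_zero (h : Realizes N₁ N₂ T) :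
    T.2.1.repᵀ *ᵥ T.2.2.rep = 0 := by
  have hepi := h.isEpipolar.swap
  obtain ⟨-, C₁, C₂, h₁, -, -, c, hc, he₂⟩ := h
  have hF := hepi.mulVec_eq_zero_iff.2 (Submodule.mem_sup_right h₁.2)
  rw [he₂, Matrix.mulVec_smul] at hF
  exact (smul_eq_zero.1 hF).resolve_left hc

theorem ext (h : Realizes N₁ N₂ T) {N₁' N₂' : Matrix (Fin 3) (Fin 4) ℂ}
    (h' : Realizes N₁' N₂' T') (hF : T.2.1 = T'.2.1) : T = T' := by
  obtain ⟨c₁, hc₁⟩ := h'.isEpipolar.exists_eq_smul_of_mulVec_eq_zero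
    (hF ▸ h.mulVec_epipole_eq_zero) h'.mulVec_epipole_eq_zero T'.1.rep_nonzero
  obtain ⟨c₂, hc₂⟩ := h'.isEpipolar.swap.exists_eq_smul_of_mulVec_eq_zero
    (hF ▸ h.transpose_mulVec_epipole_eq_zero) h'.transpose_mulVec_epipole_eq_zero
    T'.2.2.rep_nonzero
  have he₁ := (eq_mk_of_rep_eq_smul T'.1.rep_nonzero hc₁).trans T'.1.mk_rep
  have he₂ := (eq_mk_of_rep_eq_smul T'.2.2.rep_nonzero hc₂).trans T'.2.2.mk_rep
  exact Prod.ext he₁ (Prod.ext hF he₂)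

theorem hasEpipolarTangent_of_mem_spaceTangencyPoints (h : Realizes N₁ N₂ T)
    (hn₁ : f₁.IsHomogeneous n₁) (hn₂ : f₂.IsHomogeneous n₂)
    (hP : P ∈ spaceTangencyPoints f₁ f₂ N₁ N₂ T.1 T.2.2) :
    HasEpipolarTangent f₁ N₁ N₂ P.rep ∧ HasEpipolarTangent f₂ N₂ N₁ P.rep := by
  obtain ⟨-, C₁, C₂, h₁, h₂, he₁, he₂⟩ := h
  exact ⟨h₂.hasEpipolarTangent he₁ hn₁ hP.1, h₁.hasEpipolarTangent he₂ hn₂ hP.2⟩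

end Realizes

theorem eventually_liesOnQuadric {α : Type*} {U : Ultrafilter α} (hU : (U : Filter α) ≤ cofinite)
    (hf₁ : Irreducible f₁) (hf₂ : Irreducible f₂) (hn₁ : f₁.IsHomogeneous n₁)
    (hn₂ : f₂.IsHomogeneous n₂) {T : α → P2 × P8 × P2} (hT : Function.Injective T)
    {N₁ N₂ : α → Matrix (Fin 3) (Fin 4) ℂ} (h : ∀ a, Realizes (N₁ a) (N₂ a) (T a)) :
    ∀ᶠ a in U, LiesOnQuadric (baseline (N₁ a) (N₂ a) ∪
      spaceTangencyPoints f₁ f₂ (N₁ a) (N₂ a) (T a).1 (T a).2.2) := by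
  have hF : Function.Injective fun a => (T a).2.1 := fun a b hab => hT ((h a).ext (h b) hab)
  obtain ⟨c, hc, i, j, hij, D, a, b, hab⟩ := exists_derivation_smul_matLim_rep_ne_zero hU hF
  refine (eventually_exists_quadraticForm (fun a => (h a).isEpipolar) hf₁ hf₂ hn₁ hn₂ hc hij D
    hab).mono ?_
  rintro a ⟨B, hB0, hB⟩
  exact ⟨B, hB0, fun P hP => hB P.rep <|
    hP.imp_right ((h a).hasEpipolarTangent_of_mem_spaceTangencyPoints hn₁ hn₂)⟩

end Realization

instance projectivization_t1Space (E : Type*) [AddCommGroup E] [Module ℂ E] [TopologicalSpace E]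
    [IsTopologicalAddGroup E] [ContinuousSMul ℂ E] [T2Space E] : T1Space (ℙ ℂ E) where
  t1 x := by
    refine isClosed_coinduced.2 ?_
    have hpreimage : (fun v : { v : E // v ≠ 0 } => Projectivization.mk ℂ v.1 v.2) ⁻¹' {x} =
        Subtype.val ⁻¹' (Submodule.span ℂ {x.rep} : Set E) := by
      ext v
      rw [Set.mem_preimage, Set.mem_singleton_iff, Set.mem_preimage, SetLike.mem_coe,
        Submodule.mem_span_singleton]
      conv_lhs => rw [← x.mk_rep]
      exact Projectivization.mk_eq_mk_iff' ..
    rw [hpreimage]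
    exact (Submodule.closed_of_finiteDimensional _).preimage continuous_subtype_val

end TwoViews

theorem mainTheorem8_general {f₁ f₂ : MvPolynomial (Fin 3) ℂ} (hf₁ : Irreducible f₁)
    (hf₂ : Irreducible f₂) (hn₁ : ∃ n, f₁.IsHomogeneous n) (hn₂ : ∃ n, f₂.IsHomogeneous n)
    {S : Set (TwoViews.P2 × TwoViews.P8 × TwoViews.P2)}
    (hS : ∀ T ∈ S, ∃ N₁ N₂ : Matrix (Fin 3) (Fin 4) ℂ, TwoViews.Realizes N₁ N₂ T ∧
      ¬ TwoViews.LiesOnQuadric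
        (TwoViews.baseline N₁ N₂ ∪ TwoViews.spaceTangencyPoints f₁ f₂ N₁ N₂ T.1 T.2.2)) :
    IsDiscrete S ∧ S.Finite := by
  suffices hfin : S.Finite from ⟨hfin.isDiscrete, hfin⟩
  by_contra hinf
  have := Set.infinite_coe_iff.2 hinf
  obtain ⟨n₁, hn₁⟩ := hn₁
  obtain ⟨n₂, hn₂⟩ := hn₂
  choose N₁ N₂ hreal hquad using fun T : S => hS T T.2
  obtain ⟨T, hT⟩ := (TwoViews.eventually_liesOnQuadric (Filter.hyperfilter_le_cofinite (α := S))
    hf₁ hf₂ hn₁ hn₂ Subtype.val_injective hreal).exists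
  exact hquad T hT

theorem mainTheorem8 (X : Set TwoViews.P3) (hX : TwoViews.IsSmoothIrreducibleCurve X)
    (hplanar : ¬ TwoViews.IsPlanar X) :
    TwoViews.ForGenericCentres fun O₁ O₂ =>
      ∀ M₁ M₂ : Matrix (Fin 3) (Fin 4) ℂ,
        TwoViews.IsProjectionFrom M₁ O₁ → TwoViews.IsProjectionFrom M₂ O₂ →
      ∀ f₁ f₂ φ₁ φ₂ : MvPolynomial (Fin 3) ℂ,
        TwoViews.IsEquationOf f₁ (TwoViews.projected M₁ X) →
        TwoViews.IsEquationOf f₂ (TwoViews.projected M₂ X) →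
        TwoViews.IsEquationOf φ₁ (TwoViews.dualCurve f₁) →
        TwoViews.IsEquationOf φ₂ (TwoViews.dualCurve f₂) →
        (∀ T ∈ TwoViews.kruppaVariety φ₁ φ₂,
          ∃ N₁ N₂ : Matrix (Fin 3) (Fin 4) ℂ, TwoViews.Realizes N₁ N₂ T ∧
            ¬ TwoViews.LiesOnQuadric
              (TwoViews.baseline N₁ N₂ ∪
                TwoViews.spaceTangencyPoints f₁ f₂ N₁ N₂ T.1 T.2.2)) →
        IsDiscrete (TwoViews.kruppaVariety φ₁ φ₂) ∧
          (TwoViews.kruppaVariety φ₁ φ₂).Finite :=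
  ⟨1, one_ne_zero, fun _ _ _ _ _ _ _ _ _ _ _ _ _ hf₁ hf₂ _ _ =>
    mainTheorem8_general hf₁.1 hf₂.1 hf₁.2.1 hf₂.2.1⟩
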